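/- Let $k,n\ge 0$ be integers. A $k$-cosymplectic structure on a smooth manifold $M$ of dimension $k(n+1)+n$ is a family $(\eta^\alpha,\omega^\alpha,V;\ 1\le\alpha\le k)$, where the $\eta^\alpha$ are smooth closed $1$-forms, the $\omega^\alpha$ are smooth closed $2$-forms and $V$ is an integrable distribution of dimension $nk$ on $M$, such that at every point (i) $\eta^1\wedge\dots\wedge\eta^k\neq 0$, $\ \eta^\alpha|_V=0$, $\ \omega^\alpha|_{V\times V}=0$ for all $\alpha$; (ii) $\bigl(\bigcap_\alpha\ker\eta^\alpha\bigr)\cap\bigl(\bigcap_\alpha\ker\omega^\alpha\bigr)=\{0\}$ and $\dim\bigcap_\alpha\ker\omega^\alpha=k$, where $\ker\omega^\alpha=\{v:\ i_v\omega^\alpha=0\}$. Its Reeb vector fields $R_1,\dots,R_k$ are the unique vector fields with $i_{R_\alpha}\eta^\beta=\delta^\beta_\alpha$ and $i_{R_\alpha}\omega^\beta=0$ for all $\alpha,\beta$. Darboux coordinates are smooth local coordinates $(x^\alpha,q^i,p^\alpha_i)$, $1\le\alpha\le k$, $1\le i\le n$, on an open subset of $M$ in which $\eta^\alpha=dx^\alpha$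 and $\omega^\alpha=\sum_i dq^i\wedge dp^\alpha_i$. A $k$-vector field on $M$ is a family $X=(X_1,\dots,X_k)$ of smooth vector fields on $M$. An integral section of $X$ through $p\in M$ is a map $\psi:U\to M$, differentiable on an open neighbourhood $U\subseteq\mathbb R^k$ of $0$, with $\psi(0)=p$ and $T\psi\bigl(\tfrac{\partial}{\partial x^\alpha}\big|_x\bigr)=X_\alpha(\psi(x))$ for all $x\in U$ and all $\alpha$. **Theorem.** Let $(\eta^\alpha,\omega^\alpha,V)$ be a $k$-cosymplectic structure on $M$, let $H:M\to\mathbb R$ be smooth, and let $X=(X_1,\dots,X_k)$ be a $k$-vector field on $M$ with $$\eta^\alpha(X_\beta)=\delta^\alpha_\beta\quad(1\le\alpha,\beta\le k),\qquad \sum_{\alpha=1}^k i_{X_\alpha}\omega^\alpha=dH-\sum_{\alpha=1}^k R_\alpha(H)\,\eta^\alpha .$$ Then every integral section $\psi:U\to M$ of $X$, through any point of $M$, is a solution of the Hamilton--De Donder--Weyl field equations. That is, for all Darboux coordinates $(x^\alpha,q^i,p^\alpha_i)$ and every $x\in U$ with $\psi(x)$ in their domain, there is a constant $c\in\mathbb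 R^k$ such that near $x$ the map $\psi$ has the form $y\mapsto(y+c,\psi^i(y),\psi^\alpha_i(y))$ in these coordinates, the functions $\psi^i,\psi^\alpha_i$ are differentiable at $x$, and $$\frac{\partial\psi^i}{\partial x^\alpha}\Big|_x=\frac{\partial H}{\partial p^\alpha_i}\Big|_{\psi(x)},\qquad \sum_{\alpha=1}^k\frac{\partial\psi^\alpha_i}{\partial x^\alpha}\Big|_x=-\frac{\partial H}{\partial q^i}\Big|_{\psi(x)}\qquad(1\le i\le n,\ 1\le\alpha\le k).$$ -/

import Mathlib

open scoped Manifold ContDiff Topology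

noncomputable section

namespace KCosymp

section Forms

variable (E : Type*) [NormedAddCommGroup E] [NormedSpace ℝ E]
variable (M : Type*) [TopologicalSpace M] [ChartedSpace E M]

/-- (Not necessarily smooth) `1`-forms on `M`. -/
abbrev OneForm : Type _ := ∀ p : M, TangentSpace 𝓘(ℝ, E) p →L[ℝ] ℝ

/-- (Not necessarily smooth) differential forms of degree `r` on `M`. -/
abbrev DiffForm (r : ℕ) : Type _ := ∀ p : M, TangentSpace 𝓘(ℝ, E) p [⋀^Fin r]→L[ℝ] ℝ

variable {E M}

/-- A `1`-form regarded as a differential form of degree `1`. -/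
def OneForm.toDiffForm (η : OneForm E M) : DiffForm E M 1 := fun p =>
  ContinuousAlternatingMap.ofSubsingleton ℝ (TangentSpace 𝓘(ℝ, E) p) ℝ (0 : Fin 1) (η p)

/-- The coordinate expression of a differential form in a chart `e`: the pullback of the form by
the inverse chart `e.symm`. It is meaningful on `e.target`. -/
def DiffForm.inChart {r : ℕ} (Ω : DiffForm E M r) (e : OpenPartialHomeomorph M E) :
    E → E [⋀^Fin r]→L[ℝ] ℝ := fun y =>
  (Ω (e.symm y)).compContinuousLinearMap
    ((mfderiv 𝓘(ℝ, E) 𝓘(ℝ, E) e.symm y).comp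
      (NormedSpace.fromTangentSpace (𝕜 := ℝ) y).symm.toContinuousLinearMap)

/-- A differential form is smooth if its expression in every chart of the atlas is smooth. -/
def DiffForm.IsSmooth {r : ℕ} (Ω : DiffForm E M r) : Prop :=
  ∀ e ∈ atlas E M, ContDiffOn ℝ ∞ (Ω.inChart e) e.target

/-- A differential form is closed if the exterior derivative of its expression in every chart of
the atlas vanishes. -/
def DiffForm.IsClosed {r : ℕ} (Ω : DiffForm E M r) : Prop :=
  ∀ e ∈ atlas E M, ∀ y ∈ e.target, extDeriv (Ω.inChart e) y = 0

/-- The kernel `{v | i_v ω = 0}` of a `2`-form at a point. -/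
def DiffForm.kerAt (Ω : DiffForm E M 2) (p : M) : Submodule ℝ (TangentSpace 𝓘(ℝ, E) p) :=
  LinearMap.ker ((Ω p).toAlternatingMap.curryLeft)

/-- The wedge product `η¹ ∧ ⋯ ∧ ηᵏ` of `1`-forms at a point,
`(v₁, …, v_k) ↦ det (η^α(v_β))`. -/
def wedgeAt {k : ℕ} (η : Fin k → OneForm E M) (p : M) :
    TangentSpace 𝓘(ℝ, E) p [⋀^Fin k]→ₗ[ℝ] ℝ :=
  (Matrix.detRowAlternating (n := Fin k) (R := ℝ)).compLinearMap
    (LinearMap.pi fun α => ((η α p : TangentSpace 𝓘(ℝ, E) p →L[ℝ] ℝ) :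
      TangentSpace 𝓘(ℝ, E) p →ₗ[ℝ] ℝ))

/-- A coordinate system on an open subset of `M`, with values in a normed space `F`, that is
compatible with the smooth structure of `M`. -/
def IsSmoothChart {F : Type*} [NormedAddCommGroup F] [NormedSpace ℝ F]
    (φ : OpenPartialHomeomorph M F) : Prop :=
  ContMDiffOn 𝓘(ℝ, E) 𝓘(ℝ, F) ∞ φ φ.source ∧
    ContMDiffOn 𝓘(ℝ, F) 𝓘(ℝ, E) ∞ φ.symm φ.target

/-- A family `V` of subspaces of the tangent spaces is an integrable (smooth) distribution of
dimension `d` and codimension `c`: around each point there are coordinates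
`(y, z)`, `y ∈ ℝᶜ`, `z ∈ ℝᵈ`, in which the slices `y = const` are integral manifolds of `V`,
that is, `V = {dy = 0}`. -/
def IsIntegrableDistribution (c d : ℕ)
    (V : ∀ p : M, Submodule ℝ (TangentSpace 𝓘(ℝ, E) p)) : Prop :=
  ∀ p : M, ∃ χ : OpenPartialHomeomorph M ((Fin c → ℝ) × (Fin d → ℝ)),
    p ∈ χ.source ∧ IsSmoothChart (E := E) χ ∧
    ∀ z ∈ χ.source, V z = LinearMap.ker
      ((mvfderiv 𝓘(ℝ, E) (fun y => (χ y).1) z : TangentSpace 𝓘(ℝ, E) z →L[ℝ] (Fin c → ℝ)) :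
        TangentSpace 𝓘(ℝ, E) z →ₗ[ℝ] (Fin c → ℝ))

end Forms

/-- A `k`-cosymplectic structure on the manifold `M` of dimension `k(n+1)+n`. -/
structure KCosymplecticStructure (k n : ℕ)
    (E : Type*) [NormedAddCommGroup E] [NormedSpace ℝ E] [FiniteDimensional ℝ E]
    (M : Type*) [TopologicalSpace M] [ChartedSpace E M] where
  η : Fin k → OneForm E M
  Ω : Fin k → DiffForm E M 2
  V : ∀ p : M, Submodule ℝ (TangentSpace 𝓘(ℝ, E) p)
  dim_eq : Module.finrank ℝ E = k * (n + 1) + n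
  smooth_η : ∀ α, (η α).toDiffForm.IsSmooth
  closed_η : ∀ α, (η α).toDiffForm.IsClosed
  smooth_Ω : ∀ α, (Ω α).IsSmooth
  closed_Ω : ∀ α, (Ω α).IsClosed
  finrank_V : ∀ p, Module.finrank ℝ (V p) = n * k
  integrable_V : IsIntegrableDistribution (k + n) (n * k) V
  wedge_ne_zero : ∀ p, wedgeAt η p ≠ 0
  η_V : ∀ α p, ∀ v ∈ V p, η α p v = 0
  Ω_V : ∀ α p, ∀ v ∈ V p, ∀ w ∈ V p, Ω α p ![v, w] = 0
  ker_inf : ∀ p, (⨅ α, LinearMap.ker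
      ((η α p : TangentSpace 𝓘(ℝ, E) p →L[ℝ] ℝ) : TangentSpace 𝓘(ℝ, E) p →ₗ[ℝ] ℝ)) ⊓
      (⨅ α, (Ω α).kerAt p) = ⊥
  finrank_ker : ∀ p,
    Module.finrank ℝ (⨅ α, (Ω α).kerAt p : Submodule ℝ (TangentSpace 𝓘(ℝ, E) p)) = k

section System

variable {k n : ℕ} {E : Type*} [NormedAddCommGroup E] [NormedSpace ℝ E] [FiniteDimensional ℝ E]
  {M : Type*} [TopologicalSpace M] [ChartedSpace E M]

namespace KCosymplecticStructure

/-- At every point there is exactly one vector `R_α` with `i_{R_α} η^β = δ^β_α` and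
`i_{R_α} ω^β = 0`. -/
theorem existsUnique_reeb (S : KCosymplecticStructure k n E M) (α : Fin k) (p : M) :
    ∃! v : TangentSpace 𝓘(ℝ, E) p,
      (∀ β, S.η β p v = if β = α then 1 else 0) ∧ ∀ β, ∀ w, S.Ω β p ![v, w] = 0 := by
  have : FiniteDimensional ℝ (TangentSpace 𝓘(ℝ, E) p) :=
    inferInstanceAs (FiniteDimensional ℝ E)
  let K : Submodule ℝ (TangentSpace 𝓘(ℝ, E) p) := ⨅ α, (S.Ω α).kerAt p
  have memK : ∀ v, v ∈ K ↔ ∀ β, ∀ w, S.Ω β p ![v, w] = 0 := by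
    intro v
    simp only [K, Submodule.mem_iInf, DiffForm.kerAt, LinearMap.mem_ker]
    refine forall_congr' fun β => ⟨fun h w => ?_, fun h => ?_⟩
    · have := DFunLike.congr_fun h ![w]
      simpa using this
    · ext u
      have : u = ![u 0] := by ext i; fin_cases i; rfl
      rw [this]
      simpa using h (u 0)
  let f : TangentSpace 𝓘(ℝ, E) p →ₗ[ℝ] (Fin k → ℝ) :=
    LinearMap.pi fun β => ((S.η β p : TangentSpace 𝓘(ℝ, E) p →L[ℝ] ℝ) :
      TangentSpace 𝓘(ℝ, E) p →ₗ[ℝ] ℝ)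
  have zero_of : ∀ v ∈ K, f v = 0 → v = 0 := by
    intro v hv h0
    have : v ∈ (⊥ : Submodule ℝ (TangentSpace 𝓘(ℝ, E) p)) := by
      rw [← S.ker_inf p]
      refine ⟨?_, hv⟩
      simp only [SetLike.mem_coe, Submodule.mem_iInf, LinearMap.mem_ker]
      exact fun β => congrFun h0 β
    simpa using this
  have inj : Function.Injective (f.domRestrict K) := by
    rw [← LinearMap.ker_eq_bot, LinearMap.ker_eq_bot']
    exact fun v h => Subtype.ext (zero_of v v.2 h)
  have surj : Function.Surjective (f.domRestrict K) :=
    (LinearMap.injective_iff_surjective_of_finrank_eq_finrank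
      (by rw [S.finrank_ker p]; simp)).1 inj
  obtain ⟨v, hv⟩ := surj (fun β => if β = α then 1 else 0)
  refine ⟨v, ⟨fun β => congrFun hv β, (memK v).1 v.2⟩, ?_⟩
  rintro w ⟨h1, h2⟩
  have : w - v = 0 := by
    refine zero_of _ (K.sub_mem ((memK w).2 h2) v.2) ?_
    rw [map_sub, sub_eq_zero]
    funext β
    exact (h1 β).trans (congrFun hv β).symm
  exact sub_eq_zero.1 this

/-- The Reeb vector fields `R_1, …, R_k`, characterized by `i_{R_α} η^β = δ^β_α` and
`i_{R_α} ω^β = 0`. -/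
def reeb (S : KCosymplecticStructure k n E M) (α : Fin k) (p : M) : TangentSpace 𝓘(ℝ, E) p :=
  (S.existsUnique_reeb α p).choose

end KCosymplecticStructure

variable [IsManifold 𝓘(ℝ, E) ∞ M]

variable (E M) in
/-- A `k`-vector field on `M`, as the family of its `k` component (smooth) vector fields. -/
abbrev KVectorField (k : ℕ) : Type _ :=
  Fin k → Cₛ^∞⟮𝓘(ℝ, E); E, (TangentSpace 𝓘(ℝ, E) : M → Type _)⟯

/-- `X` solves the `k`-cosymplectic Hamiltonian equations
`η^α(X_β) = δ^α_β`, `∑_α i_{X_α} ω^α = dH - ∑_α R_α(H) η^α`. -/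
def IsHamiltonian (S : KCosymplecticStructure k n E M) (H : C^∞⟮𝓘(ℝ, E), M; ℝ⟯)
    (X : KVectorField E M k) : Prop :=
  (∀ α β p, S.η α p (X β p) = if α = β then 1 else 0) ∧
  ∀ (p : M) (v : TangentSpace 𝓘(ℝ, E) p),
    ∑ α, S.Ω α p ![X α p, v] =
      mvfderiv 𝓘(ℝ, E) H p v - ∑ α, mvfderiv 𝓘(ℝ, E) H p (S.reeb α p) * S.η α p v

/-- `ψ : U → M` is an integral section of `X` through `p`: `U ⊆ ℝᵏ` is an open neighbourhood
of `0`, `ψ(0) = p` and `Tψ(∂/∂x^α|_x) = X_α(ψ(x))` for all `x ∈ U` and all `α`. Values of `ψ`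
outside `U` are irrelevant. -/
def IsIntegralSection (X : KVectorField E M k) (U : Set (Fin k → ℝ)) (p : M)
    (ψ : (Fin k → ℝ) → M) : Prop :=
  IsOpen U ∧ 0 ∈ U ∧ ψ 0 = p ∧
  ∀ x ∈ U, MDifferentiableAt 𝓘(ℝ, Fin k → ℝ) 𝓘(ℝ, E) ψ x ∧
    ∀ α : Fin k, mfderiv 𝓘(ℝ, Fin k → ℝ) 𝓘(ℝ, E) ψ x
      ((NormedSpace.fromTangentSpace (𝕜 := ℝ) x).symm (Pi.single α 1)) = X α (ψ x)

/-- The space of values of Darboux coordinates `(x^α, q^i, p^α_i)`. -/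
abbrev DarbouxSpace (k n : ℕ) : Type := (Fin k → ℝ) × (Fin n → ℝ) × (Fin k → Fin n → ℝ)

/-- The coordinate vector `∂/∂q^i`. -/
def basisQ {k n : ℕ} (i : Fin n) : DarbouxSpace k n := (0, Pi.single i 1, 0)

/-- The coordinate vector `∂/∂p^α_i`. -/
def basisP {k n : ℕ} (α : Fin k) (i : Fin n) : DarbouxSpace k n :=
  (0, 0, Pi.single α (Pi.single i 1))

/-- Darboux coordinates: smooth coordinates `(x^α, q^i, p^α_i)` on an open subset of `M` in which
`η^α = dx^α` and `ω^α = ∑_i dq^i ∧ dp^α_i`. No condition is put on the distribution `V`, so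
Darboux coordinates with `V = ⟨∂/∂p^α_i⟩` are a special case. -/
structure IsDarbouxChart (S : KCosymplecticStructure k n E M)
    (φ : OpenPartialHomeomorph M (DarbouxSpace k n)) : Prop where
  smooth : IsSmoothChart (E := E) φ
  η_eq : ∀ α, ∀ z ∈ φ.source, ∀ v,
    S.η α z v = mvfderiv 𝓘(ℝ, E) (fun y => (φ y).1 α) z v
  Ω_eq : ∀ α, ∀ z ∈ φ.source, ∀ v w,
    S.Ω α z ![v, w] = ∑ i,
      (mvfderiv 𝓘(ℝ, E) (fun y => (φ y).2.1 i) z v *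
          mvfderiv 𝓘(ℝ, E) (fun y => (φ y).2.2 α i) z w -
        mvfderiv 𝓘(ℝ, E) (fun y => (φ y).2.1 i) z w *
          mvfderiv 𝓘(ℝ, E) (fun y => (φ y).2.2 α i) z v)

/-- `ψ : U → M` is a solution of the Hamilton–De Donder–Weyl equations. In all Darboux coordinates
`(x^α, q^i, p^α_i)` and around every `x ∈ U` with `ψ(x)` in their domain, `ψ` has the local form
`y ↦ (y + c, ψ^i(y), ψ^α_i(y))` with a constant `c`, the functions `ψ^i`, `ψ^α_i` are
differentiable at `x`, and
`∂ψ^i/∂x^α|_x = ∂H/∂p^α_i|_{ψ(x)}`, `∑_α ∂ψ^α_i/∂x^α|_x = -∂H/∂q^i|_{ψ(x)}`. -/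
def IsHDWSolution (S : KCosymplecticStructure k n E M) (H : M → ℝ) (U : Set (Fin k → ℝ))
    (ψ : (Fin k → ℝ) → M) : Prop :=
  ∀ φ : OpenPartialHomeomorph M (DarbouxSpace k n), IsDarbouxChart S φ →
    ∀ x ∈ U, ψ x ∈ φ.source →
      (∃ c : Fin k → ℝ, ∀ᶠ y in 𝓝 x, (φ (ψ y)).1 = y + c) ∧
      (∀ i, DifferentiableAt ℝ (fun y => (φ (ψ y)).2.1 i) x) ∧
      (∀ α i, DifferentiableAt ℝ (fun y => (φ (ψ y)).2.2 α i) x) ∧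
      (∀ α i, fderiv ℝ (fun y => (φ (ψ y)).2.1 i) x (Pi.single α 1) =
        fderiv ℝ (H ∘ φ.symm) (φ (ψ x)) (basisP α i)) ∧
      ∀ i, ∑ α, fderiv ℝ (fun y => (φ (ψ y)).2.2 α i) x (Pi.single α 1) =
        -fderiv ℝ (H ∘ φ.symm) (φ (ψ x)) (basisQ i)

end System

end KCosymp

end

/-!
Every statement about `ψ` in Darboux coordinates is a statement about the derivative of `f ∘ ψ` for
a scalar function `f` on `M`, namely a coordinate function, and the chain rule gives
`∂(f ∘ ψ)/∂x^α = df(X_α)` (`IsIntegralSection.fderiv_comp`).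

* Since `η^α = dx^α`, the condition `η^α(X_β) = δ^α_β` says that `x^α ∘ ψ` and the `α`-th
  coordinate of `ℝᵏ` have the same derivative, hence differ by a constant on a ball.
* In Darboux coordinates `∑_α i_{X_α} ω^α = ∑_{α, i} (dq^i(X_α) dp^α_i - dp^α_i(X_α) dq^i)`.
  Evaluating the Hamiltonian equation on `∂/∂p^α_i` and on `∂/∂q^i`, which are annihilated by all
  the `η^β = dx^β`, so that the Reeb terms drop out, gives `dq^i(X_α) = ∂H/∂p^α_i` and
  `-∑_α dp^α_i(X_α) = ∂H/∂q^i`.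

The coordinate vectors enter as the tangent vectors of
`IsSmoothChart.exists_mvfderiv_eq_fderiv`.
-/

open NormedSpace (fromTangentSpace)

namespace KCosymp

section Charts

variable {E : Type*} [NormedAddCommGroup E] [NormedSpace ℝ E]
  {M : Type*} [TopologicalSpace M] [ChartedSpace E M]
  {F : Type*} [NormedAddCommGroup F] [NormedSpace ℝ F]

theorem IsSmoothChart.mdifferentiableAt {φ : OpenPartialHomeomorph M F}
    (hφ : IsSmoothChart (E := E) φ) {z : M} (hz : z ∈ φ.source) :
    MDifferentiableAt 𝓘(ℝ, E) 𝓘(ℝ, F) φ z :=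
  (hφ.1.contMDiffAt (φ.open_source.mem_nhds hz)).mdifferentiableAt (by simp)

theorem IsSmoothChart.mdifferentiableAt_symm {φ : OpenPartialHomeomorph M F}
    (hφ : IsSmoothChart (E := E) φ) {y : F} (hy : y ∈ φ.target) :
    MDifferentiableAt 𝓘(ℝ, F) 𝓘(ℝ, E) φ.symm y :=
  (hφ.2.contMDiffAt (φ.open_target.mem_nhds hy)).mdifferentiableAt (by simp)

theorem IsSmoothChart.mdifferentiableAt_clm_comp {φ : OpenPartialHomeomorph M F}
    (hφ : IsSmoothChart (E := E) φ) (L : F →L[ℝ] ℝ) {z : M} (hz : z ∈ φ.source) :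
    MDifferentiableAt 𝓘(ℝ, E) 𝓘(ℝ, ℝ) (fun y => L (φ y)) z :=
  L.differentiableAt.mdifferentiableAt.comp z (hφ.mdifferentiableAt hz)

/-- Every vector `u` of the coordinate space is the coordinate expression of a tangent vector:
there is `v` with `df(v) = ∂f/∂u` for all `f`. For `u` a basis vector, `v` is the corresponding
coordinate vector field at `z`. -/
theorem IsSmoothChart.exists_mvfderiv_eq_fderiv {φ : OpenPartialHomeomorph M F}
    (hφ : IsSmoothChart (E := E) φ) {z : M} (hz : z ∈ φ.source) (u : F) :
    ∃ v : TangentSpace 𝓘(ℝ, E) z, ∀ f : M → ℝ, MDifferentiableAt 𝓘(ℝ, E) 𝓘(ℝ, ℝ) f z →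
      mvfderiv 𝓘(ℝ, E) f z v = fderiv ℝ (f ∘ φ.symm) (φ z) u := by
  -- Writing `z` as `φ.symm y` avoids transporting tangent vectors along `φ.symm (φ z) = z`.
  obtain ⟨y, hy, rfl⟩ : ∃ y ∈ φ.target, φ.symm y = z :=
    ⟨φ z, φ.map_source hz, φ.left_inv hz⟩
  refine ⟨mfderiv 𝓘(ℝ, F) 𝓘(ℝ, E) φ.symm y ((fromTangentSpace (𝕜 := ℝ) y).symm u),
    fun f hf => ?_⟩
  rw [← mvfderiv_comp_apply y hf (hφ.mdifferentiableAt_symm hy), φ.right_inv hy]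
  simp only [mvfderiv, mfderiv_eq_fderiv]
  rfl

theorem fderiv_clm_comp_chart_symm (φ : OpenPartialHomeomorph M F) (L : F →L[ℝ] ℝ) {z : M}
    (hz : z ∈ φ.source) (u : F) :
    fderiv ℝ ((fun y => L (φ y)) ∘ φ.symm) (φ z) u = L u := by
  have h : (fun y => L (φ y)) ∘ φ.symm =ᶠ[𝓝 (φ z)] L := by
    filter_upwards [φ.open_target.mem_nhds (φ.map_source hz)] with y hy
    simp [φ.right_inv hy]
  rw [h.fderiv_eq, L.fderiv]

end Charts

section System

variable {k n : ℕ} {E : Type*} [NormedAddCommGroup E] [NormedSpace ℝ E]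
  {M : Type*} [TopologicalSpace M] [ChartedSpace E M]

/-- The coordinate `x^α` on the space of values of Darboux coordinates. -/
def coordX (α : Fin k) : DarbouxSpace k n →L[ℝ] ℝ :=
  (ContinuousLinearMap.proj α).comp (ContinuousLinearMap.fst ℝ _ _)

/-- The coordinate `q^i` on the space of values of Darboux coordinates. -/
def coordQ (i : Fin n) : DarbouxSpace k n →L[ℝ] ℝ :=
  (ContinuousLinearMap.proj i).comp
    ((ContinuousLinearMap.fst ℝ _ _).comp (ContinuousLinearMap.snd ℝ _ _))

/-- The coordinate `p^α_i` on the space of values of Darboux coordinates. -/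
def coordP (α : Fin k) (i : Fin n) : DarbouxSpace k n →L[ℝ] ℝ :=
  (ContinuousLinearMap.proj (R := ℝ) (φ := fun _ : Fin n => ℝ) i).comp
    ((ContinuousLinearMap.proj (R := ℝ) (φ := fun _ : Fin k => Fin n → ℝ) α).comp
      ((ContinuousLinearMap.snd ℝ _ _).comp (ContinuousLinearMap.snd ℝ _ _)))

variable [IsManifold 𝓘(ℝ, E) ∞ M]

namespace IsIntegralSection

variable {X : KVectorField E M k} {U : Set (Fin k → ℝ)} {p : M} {ψ : (Fin k → ℝ) → M}

theorem differentiableAt_comp (hψ : IsIntegralSection X U p ψ) {x : Fin k → ℝ} (hx : x ∈ U)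
    {f : M → ℝ} (hf : MDifferentiableAt 𝓘(ℝ, E) 𝓘(ℝ, ℝ) f (ψ x)) :
    DifferentiableAt ℝ (fun y => f (ψ y)) x :=
  (hf.comp x (hψ.2.2.2 x hx).1).differentiableAt

theorem fderiv_comp (hψ : IsIntegralSection X U p ψ) {x : Fin k → ℝ} (hx : x ∈ U)
    {f : M → ℝ} (hf : MDifferentiableAt 𝓘(ℝ, E) 𝓘(ℝ, ℝ) f (ψ x)) (α : Fin k) :
    fderiv ℝ (fun y => f (ψ y)) x (Pi.single α 1) = mvfderiv 𝓘(ℝ, E) f (ψ x) (X α (ψ x)) := by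
  rw [← (hψ.2.2.2 x hx).2 α, ← mvfderiv_comp_apply x hf (hψ.2.2.2 x hx).1]
  simp only [mvfderiv, mfderiv_eq_fderiv]
  rfl

theorem continuousOn (hψ : IsIntegralSection X U p ψ) : ContinuousOn ψ U :=
  fun x hx => (hψ.2.2.2 x hx).1.continuousAt.continuousWithinAt

end IsIntegralSection

section Darboux

variable [FiniteDimensional ℝ E] {S : KCosymplecticStructure k n E M} {H : C^∞⟮𝓘(ℝ, E), M; ℝ⟯}
  {X : KVectorField E M k} {φ : OpenPartialHomeomorph M (DarbouxSpace k n)}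

/-- The Hamiltonian equation `∑_α i_{X_α} ω^α = dH - ∑_α R_α(H) η^α` evaluated, in Darboux
coordinates, on a vector `u` without `∂/∂x^α`-components. -/
theorem IsHamiltonian.sum_coord_eq (hX : IsHamiltonian S H X) (hφ : IsDarbouxChart S φ)
    {z : M} (hz : z ∈ φ.source) {u : DarbouxSpace k n} (hu : u.1 = 0) :
    ∑ α, ∑ i, (mvfderiv 𝓘(ℝ, E) (fun y => (φ y).2.1 i) z (X α z) * u.2.2 α i -
        u.2.1 i * mvfderiv 𝓘(ℝ, E) (fun y => (φ y).2.2 α i) z (X α z)) =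
      fderiv ℝ (H ∘ φ.symm) (φ z) u := by
  obtain ⟨v, hv⟩ := hφ.smooth.exists_mvfderiv_eq_fderiv hz u
  have hL (L : DarbouxSpace k n →L[ℝ] ℝ) : mvfderiv 𝓘(ℝ, E) (fun y => L (φ y)) z v = L u :=
    (hv _ (hφ.smooth.mdifferentiableAt_clm_comp L hz)).trans (fderiv_clm_comp_chart_symm φ L hz u)
  have hη (α : Fin k) : S.η α z v = 0 :=
    (hφ.η_eq α z hz v).trans ((hL (coordX α)).trans (congrFun hu α))
  have hq (i : Fin n) : mvfderiv 𝓘(ℝ, E) (fun y => (φ y).2.1 i) z v = u.2.1 i := hL (coordQ i)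
  have hp (α : Fin k) (i : Fin n) :
      mvfderiv 𝓘(ℝ, E) (fun y => (φ y).2.2 α i) z v = u.2.2 α i := hL (coordP α i)
  have h := hX.2 z v
  rw [hv H (H.contMDiff.mdifferentiable (by simp) z)] at h
  simpa only [hη, mul_zero, Finset.sum_const_zero, sub_zero, hφ.Ω_eq _ z hz, hq, hp] using h

theorem IsHamiltonian.mvfderiv_q (hX : IsHamiltonian S H X) (hφ : IsDarbouxChart S φ)
    {z : M} (hz : z ∈ φ.source) (α : Fin k) (i : Fin n) :
    mvfderiv 𝓘(ℝ, E) (fun y => (φ y).2.1 i) z (X α z) =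
      fderiv ℝ (H ∘ φ.symm) (φ z) (basisP α i) := by
  rw [← hX.sum_coord_eq hφ hz rfl, Finset.sum_eq_single α, Finset.sum_eq_single i]
  · simp [basisP]
  · intro j _ hj
    simp [basisP, hj]
  · simp
  · intro β _ hβ
    simp [basisP, hβ]
  · simp

theorem IsHamiltonian.sum_mvfderiv_p (hX : IsHamiltonian S H X) (hφ : IsDarbouxChart S φ)
    {z : M} (hz : z ∈ φ.source) (i : Fin n) :
    ∑ α, mvfderiv 𝓘(ℝ, E) (fun y => (φ y).2.2 α i) z (X α z) =
      -fderiv ℝ (H ∘ φ.symm) (φ z) (basisQ i) := by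
  rw [← hX.sum_coord_eq hφ hz rfl, ← Finset.sum_neg_distrib]
  refine Finset.sum_congr rfl fun α _ => ?_
  rw [Finset.sum_eq_single i]
  · simp [basisQ]
  · intro j _ hj
    simp [basisQ, hj]
  · simp

/-- The coordinates `x^α` along an integral section are those of `ℝᵏ` up to a constant, since
`dx^α(X_β) = η^α(X_β) = δ^α_β`. -/
theorem IsIntegralSection.exists_eventually_coord_eq_add (hX : IsHamiltonian S H X)
    (hφ : IsDarbouxChart S φ) {U : Set (Fin k → ℝ)} {p : M} {ψ : (Fin k → ℝ) → M}
    (hψ : IsIntegralSection X U p ψ) {x : Fin k → ℝ} (hx : x ∈ U) (hz : ψ x ∈ φ.source) :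
    ∃ c : Fin k → ℝ, ∀ᶠ y in 𝓝 x, (φ (ψ y)).1 = y + c := by
  obtain ⟨r, hr, hball⟩ := Metric.isOpen_iff.1
    (hψ.continuousOn.isOpen_inter_preimage hψ.1 φ.open_source) x ⟨hx, hz⟩
  have hmd (α : Fin k) {y : Fin k → ℝ} (hy : y ∈ Metric.ball x r) :
      MDifferentiableAt 𝓘(ℝ, E) 𝓘(ℝ, ℝ) (fun w => (φ w).1 α) (ψ y) :=
    hφ.smooth.mdifferentiableAt_clm_comp (coordX α) (hball hy).2
  have key (α : Fin k) :
      ∃ a : ℝ, Set.EqOn (fun y => (φ (ψ y)).1 α) (fun y => y α + a) (Metric.ball x r) := by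
    let π : (Fin k → ℝ) →L[ℝ] ℝ := ContinuousLinearMap.proj α
    refine Metric.isOpen_ball.exists_eq_add_of_fderiv_eq (𝕜 := ℝ) (g := π)
      (convex_ball x r).isPreconnected ?_ π.differentiable.differentiableOn ?_
    · exact fun y hy =>
        (hψ.differentiableAt_comp (hball hy).1 (hmd α hy)).differentiableWithinAt
    · intro y hy
      refine ContinuousLinearMap.coe_injective (LinearMap.pi_ext' fun β => LinearMap.ext_ring ?_)
      have h := hψ.fderiv_comp (hball hy).1 (hmd α hy) β
      rw [← hφ.η_eq α _ (hball hy).2, hX.1 α β] at h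
      simpa [π, Pi.single_apply] using h
  choose c hc using key
  exact ⟨c, Filter.eventually_of_mem (Metric.ball_mem_nhds x hr)
    fun y hy => funext fun α => hc α hy⟩

end Darboux

end System

end KCosymp

theorem theorem2p3 {k n : ℕ}
    {E : Type*} [NormedAddCommGroup E] [NormedSpace ℝ E] [FiniteDimensional ℝ E]
    {M : Type*} [TopologicalSpace M] [ChartedSpace E M] [IsManifold 𝓘(ℝ, E) ∞ M]
    (S : KCosymp.KCosymplecticStructure k n E M)
    (H : C^∞⟮𝓘(ℝ, E), M; ℝ⟯)
    (X : KCosymp.KVectorField E M k) (hX : KCosymp.IsHamiltonian S H X)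
    (U : Set (Fin k → ℝ)) (p : M) (ψ : (Fin k → ℝ) → M)
    (hψ : KCosymp.IsIntegralSection X U p ψ) :
    KCosymp.IsHDWSolution S H U ψ := by
  intro φ hφ x hx hz
  have hq (i : Fin n) : MDifferentiableAt 𝓘(ℝ, E) 𝓘(ℝ, ℝ) (fun w => (φ w).2.1 i) (ψ x) :=
    hφ.smooth.mdifferentiableAt_clm_comp (KCosymp.coordQ i) hz
  have hp (α : Fin k) (i : Fin n) :
      MDifferentiableAt 𝓘(ℝ, E) 𝓘(ℝ, ℝ) (fun w => (φ w).2.2 α i) (ψ x) :=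
    hφ.smooth.mdifferentiableAt_clm_comp (KCosymp.coordP α i) hz
  refine ⟨hψ.exists_eventually_coord_eq_add hX hφ hx hz,
    fun i => hψ.differentiableAt_comp hx (hq i),
    fun α i => hψ.differentiableAt_comp hx (hp α i), fun α i => ?_, fun i => ?_⟩
  · rw [hψ.fderiv_comp hx (hq i) α, hX.mvfderiv_q hφ hz]
  · rw [← hX.sum_mvfderiv_p hφ hz]
    exact Finset.sum_congr rfl fun α _ => hψ.fderiv_comp hx (hp α i) α
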